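/- For a group $G$ acting on a group $K$ by automorphisms, write $[g,k]=g(k)k^{-1}$ for $g\in G$, $k\in K$. An extended N-series of a group $H$ is a descending series of subgroups $H=H_0\ge H_1\ge H_2\ge\cdots$ with $[H_m,H_n]\le H_{m+n}$ for all $m,n\ge 0$. For a subgroup $L$ of $K$ and $n\ge 0$, let $L^n$ denote the subgroup generated by the $n$-th powers of elements of $L$. Let $K$ be a group and let $K_+=(K_m)_{m\ge 1}$ be one of the following series of $K$, where $p$ is a prime: 1. the lower central series $\Gamma_+K$: $\Gamma_1K=K$ and $\Gamma_{m+1}K=[K,\Gamma_mK]$ for $m\ge 1$; 2. the rational lower central series $\sqrt{\Gamma_+K}$: $\sqrt{\Gamma_mK}=\{x\in K\mid x^i\in\Gamma_mK\text{ for some } i\ge 1\}$ for $m\ge 1$; 3. the Zassenhaus mod-$p$ lower central series $\Gamma^{[p]}_+K$: $\Gamma^{[p]}_mK=\prod_{i\ge 1,\ j\ge 0,\ ip^j\ge m}(\Gamma_iK)^{p^j}$ for $m\ge 1$; 4. the Stallings mod-$p$ lower central series $\Gamma^{\langle p\rangle}_+K$: $\Gamma^{\langle p\rangle}_1K=K$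 and $\Gamma^{\langle p\rangle}_{m+1}K=(\Gamma^{\langle p\rangle}_mK)^p\,[K,\Gamma^{\langle p\rangle}_mK]$ for $m\ge 1$. Set $K_0=K$. Then $K_*=(K_m)_{m\ge 0}$ is an extended N-series of $K$. Let $G$ be any group acting on $K$ by automorphisms; then $g(K_n)=K_n$ for all $g\in G$, $n\ge 0$. Let $G_*=(G_m)_{m\ge 0}$ be the Johnson filtration $$G_m=\{g\in G\mid [g,k]\in K_{m+n}\text{ for all } n\ge 0,\ k\in K_n\},$$ and let $$G^1_m=\ker\bigl(G\to\operatorname{Aut}(K/K_{m+1})\bigr)=\{g\in G\mid [g,k]\in K_{m+1}\text{ for all } k\in K\}\qquad(m\ge 0).$$ Then $G_m=G^1_m$ for all $m\ge 0$. In particular, $G^1_*=(G^1_m)_{m\ge 0}$ is an extended N-series of $G$. -/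

import Mathlib

namespace NSeries

open scoped commutatorElement

/-! ### Extended N-series -/

/-- An extended N-series of a group `G`: a descending series `G = S 0 ≥ S 1 ≥ S 2 ≥ ⋯` of subgroups
with `[S m, S n] ≤ S (m + n)` for all `m, n ≥ 0`. -/
structure IsExtendedNSeries {G : Type*} [Group G] (S : ℕ → Subgroup G) : Prop where
  zero : S 0 = ⊤
  antitone : Antitone S
  commutator_le : ∀ m n, ⁅S m, S n⁆ ≤ S (m + n)

/-- The action of `G` on the group `K` by automorphisms is an action on the series `S`:
`g(S n) = S n` for all `g` and `n`. -/
def ActsOn (G : Type*) {K : Type*} [Group G] [Group K] [MulDistribMulAction G K]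
    (S : ℕ → Subgroup K) : Prop :=
  ∀ (g : G) (n : ℕ), (S n).map (MulDistribMulAction.toMulAut G K g).toMonoidHom = S n

theorem ActsOn.smul_mem {G K : Type*} [Group G] [Group K] [MulDistribMulAction G K]
    {S : ℕ → Subgroup K} (h : ActsOn G S) (g : G) {n : ℕ} {k : K} (hk : k ∈ S n) :
    g • k ∈ S n := by
  rw [← h g n]
  exact ⟨k, hk, rfl⟩

/-! ### The Johnson filtration and the kernels of the actions on the quotients -/

/-- The Johnson filtration of `G` induced by a series `S` on which `G` acts:
its `m`-th term consists of all `g` with `[g, S n] ⊆ S (m + n)` for all `n ≥ 0`,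
where `[g, k] = g(k) k⁻¹`. -/
def johnsonFiltration {G K : Type*} [Group G] [Group K] [MulDistribMulAction G K]
    (S : ℕ → Subgroup K) (h : ActsOn G S) (m : ℕ) : Subgroup G where
  carrier := {g | ∀ n, ∀ k ∈ S n, (g • k) * k⁻¹ ∈ S (m + n)}
  one_mem' := by
    intro n k _
    simp
  mul_mem' := by
    intro a b ha hb n k hk
    have h1 := mul_mem (h.smul_mem a (hb n k hk)) (ha n k hk)
    simpa [mul_smul, smul_mul'] using h1
  inv_mem' := by
    intro a ha n k hk
    have h1 := h.smul_mem a⁻¹ (inv_mem (ha n k hk))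
    simpa [smul_mul'] using h1

/-- The homomorphism `G → Aut(K / N)` induced by an action of `G` on `K` that preserves the
normal subgroup `N`. -/
def quotientAction {G K : Type*} [Group G] [Group K] [MulDistribMulAction G K]
    (N : Subgroup K) [N.Normal]
    (h : ∀ g : G, N.map (MulDistribMulAction.toMulAut G K g).toMonoidHom = N) :
    G →* MulAut (K ⧸ N) where
  toFun g := QuotientGroup.congr N N (MulDistribMulAction.toMulAut G K g) (h g)
  map_one' := by
    ext x
    induction x using QuotientGroup.induction_on with
    | H k => simp
  map_mul' a b := by
    ext x
    induction x using QuotientGroup.induction_on with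
    | H k => simp [mul_smul]

/-- The filtration `G¹` of `G`, with `m`-th term `ker (G → Aut (K / S (m + 1)))`. -/
def kernelFiltration {G K : Type*} [Group G] [Group K] [MulDistribMulAction G K]
    (S : ℕ → Subgroup K) (hN : ∀ n, (S n).Normal) (h : ActsOn G S) (m : ℕ) : Subgroup G :=
  haveI := hN (m + 1)
  (quotientAction (S (m + 1)) (fun g => h g (m + 1))).ker

/-- The `m`-th term of `G¹` consists of all `g` with `[g, K] ⊆ S (m + 1)`. -/
theorem mem_kernelFiltration_iff {G K : Type*} [Group G] [Group K] [MulDistribMulAction G K]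
    (S : ℕ → Subgroup K) (hN : ∀ n, (S n).Normal) (h : ActsOn G S) (m : ℕ) (g : G) :
    g ∈ kernelFiltration S hN h m ↔ ∀ k : K, (g • k) * k⁻¹ ∈ S (m + 1) := by
  have := hN (m + 1)
  have key : ∀ k : K, ((g • k : K) : K ⧸ S (m + 1)) = (k : K ⧸ S (m + 1)) ↔
      (g • k) * k⁻¹ ∈ S (m + 1) := by
    intro k
    rw [eq_comm, QuotientGroup.eq, (hN (m + 1)).mem_comm_iff]
  unfold kernelFiltration
  rw [MonoidHom.mem_ker]
  constructor
  · intro hg k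
    rw [← key]
    exact DFunLike.congr_fun hg (k : K ⧸ S (m + 1))
  · intro hg
    ext x
    induction x using QuotientGroup.induction_on with
    | H k => exact (key k).2 (hg k)

/-! ### The lower central series and its variants

All series are indexed by `m ≥ 0`, with terms `0` and `1` equal to the whole group. -/

/-- The lower central series `Γ_m K`: `Γ_1 K = K` and `Γ_{m+1} K = [K, Γ_m K]` for `m ≥ 1`,
extended by `Γ_0 K = K`. -/
def lowerCentral (K : Type*) [Group K] : ℕ → Subgroup K
  | 0 => ⊤
  | 1 => ⊤
  | m + 2 => ⁅(⊤ : Subgroup K), lowerCentral K (m + 1)⁆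

theorem lowerCentral_succ (K : Type*) [Group K] (m : ℕ) :
    lowerCentral K (m + 1) = (⊤ : Subgroup K).lowerCentralSeries m := by
  induction m with
  | zero => rfl
  | succ m ih =>
    rw [Subgroup.lowerCentralSeries_succ, ← ih, Subgroup.commutator_comm]
    rfl

theorem lowerCentral_characteristic (K : Type*) [Group K] (m : ℕ) :
    (lowerCentral K m).Characteristic := by
  cases m with
  | zero => exact Subgroup.topCharacteristic
  | succ m => rw [lowerCentral_succ]; infer_instance

theorem commutatorElement_pow_of_commute {Q : Type*} [Group Q] {p q : Q}
    (h : Commute p ⁅p, q⁆) (n : ℕ) : ⁅p ^ n, q⁆ = ⁅p, q⁆ ^ n := by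
  induction n with
  | zero => simp
  | succ n ih =>
    have e : ⁅p ^ (n + 1), q⁆ = p * ⁅p ^ n, q⁆ * p⁻¹ * ⁅p, q⁆ := by
      simp only [commutatorElement_def, pow_succ']
      group
    rw [e, ih, (h.pow_right n).eq, mul_inv_cancel_right, pow_succ]

/-- In a group generated by elements of finite order, every term of the lower central series
is torsion modulo the next one. -/
theorem exists_pow_mem_lowerCentralSeries {P : Type*} [Group P] (s : Set P)
    (hs : ∀ x ∈ s, IsOfFinOrder x) (hcl : Subgroup.closure s = ⊤) (i : ℕ) :
    ∀ z ∈ (⊤ : Subgroup P).lowerCentralSeries i,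
      ∃ n : ℕ, 0 < n ∧ z ^ n ∈ (⊤ : Subgroup P).lowerCentralSeries (i + 1) := by
  have fin : ∀ (j : ℕ) (z : P), IsOfFinOrder (z : P ⧸ (⊤ : Subgroup P).lowerCentralSeries j) ↔
      ∃ n : ℕ, 0 < n ∧ z ^ n ∈ (⊤ : Subgroup P).lowerCentralSeries j := by
    intro j z
    simp only [isOfFinOrder_iff_pow_eq_one, ← QuotientGroup.mk_pow, QuotientGroup.eq_one_iff]
  have comm : ∀ (j : ℕ) (a b : P), a ∈ (⊤ : Subgroup P).lowerCentralSeries j →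
      Commute (a : P ⧸ (⊤ : Subgroup P).lowerCentralSeries (j + 1)) b := by
    intro j a b ha
    rw [← commutatorElement_eq_one_iff_commute, ← QuotientGroup.mk'_apply,
      ← QuotientGroup.mk'_apply, ← map_commutatorElement, QuotientGroup.mk'_apply,
      QuotientGroup.eq_one_iff]
    exact Subgroup.commutator_mem_commutator ha (Subgroup.mem_top b)
  have gen : ∀ (j : ℕ) (t : Set P),
      (⊤ : Subgroup P).lowerCentralSeries j = Subgroup.closure t →
      (∀ z ∈ t, IsOfFinOrder (z : P ⧸ (⊤ : Subgroup P).lowerCentralSeries (j + 1))) →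
      ∀ z ∈ (⊤ : Subgroup P).lowerCentralSeries j,
        IsOfFinOrder (z : P ⧸ (⊤ : Subgroup P).lowerCentralSeries (j + 1)) := by
    intro j t ht h z hz
    rw [ht] at hz
    induction hz using Subgroup.closure_induction with
    | mem x hx => exact h x hx
    | one => exact IsOfFinOrder.one
    | mul x y hx hy ihx ihy =>
      rw [QuotientGroup.mk_mul]
      exact (comm j x y (ht ▸ hx)).isOfFinOrder_mul ihx ihy
    | inv x hx ihx =>
      rw [QuotientGroup.mk_inv]
      exact ihx.inv
  induction i with
  | zero =>
    intro z hz
    refine (fin 1 z).1 (gen 0 s (by simp [hcl]) ?_ z hz)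
    intro x hx
    exact MonoidHom.isOfFinOrder (QuotientGroup.mk' _) (hs x hx)
  | succ i ih =>
    intro z hz
    refine (fin (i + 2) z).1 (gen (i + 1)
      {x | ∃ p ∈ (⊤ : Subgroup P).lowerCentralSeries i, ∃ q ∈ (⊤ : Subgroup P), ⁅p, q⁆ = x}
      rfl ?_ z hz)
    rintro _ ⟨p, hp, q, hq, rfl⟩
    obtain ⟨n, hn, hpn⟩ := ih p hp
    rw [isOfFinOrder_iff_pow_eq_one]
    refine ⟨n, hn, ?_⟩
    have hc := (comm (i + 1) _ p (Subgroup.commutator_mem_commutator hp hq)).symm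
    have hm : ∀ a b : P, ((⁅a, b⁆ : P) : P ⧸ (⊤ : Subgroup P).lowerCentralSeries (i + 2)) =
        ⁅(a : P ⧸ (⊤ : Subgroup P).lowerCentralSeries (i + 2)), (b : P ⧸ _)⁆ :=
      fun a b => map_commutatorElement (QuotientGroup.mk' _) a b
    have hc' : Commute (p : P ⧸ (⊤ : Subgroup P).lowerCentralSeries (i + 2))
        ⁅(p : P ⧸ (⊤ : Subgroup P).lowerCentralSeries (i + 2)), (q : P ⧸ _)⁆ := by
      rw [← hm]
      exact hc
    rw [hm, ← commutatorElement_pow_of_commute hc', commutatorElement_eq_one_iff_commute,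
      ← QuotientGroup.mk_pow]
    exact comm (i + 1) _ q hpn

/-- The elements of finite order in a nilpotent group are closed under multiplication. -/
theorem isOfFinOrder_mul_of_nilpotent {Q : Type*} [Group Q] (c : ℕ)
    (hc : (⊤ : Subgroup Q).lowerCentralSeries c = ⊥) {x y : Q}
    (hx : IsOfFinOrder x) (hy : IsOfFinOrder y) : IsOfFinOrder (x * y) := by
  let H : Subgroup Q := Subgroup.closure {x, y}
  have hH : (⊤ : Subgroup H).lowerCentralSeries c = ⊥ := by
    rw [eq_bot_iff]
    intro z hz
    have h1 := Subgroup.mem_map_of_mem H.subtype hz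
    rw [Subgroup.top_subtype_lowerCentralSeries] at h1
    have h1 := Subgroup.lowerCentralSeries_mono c (le_top : H ≤ ⊤) h1
    simp only [hc, Subgroup.mem_bot] at h1
    rw [Subgroup.mem_bot]
    exact Subtype.ext h1
  have hstep := exists_pow_mem_lowerCentralSeries (P := H) (((↑) : H → Q) ⁻¹' {x, y}) (by
    rintro ⟨z, hz⟩ hzs
    rw [← Submonoid.isOfFinOrder_coe]
    rcases hzs with h | h
    · simpa [show z = x from h] using hx
    · simpa [show z = y from h] using hy) (Subgroup.closure_closure_coe_preimage)
  have hall : ∀ (i : ℕ) (z : H), ∃ n : ℕ, 0 < n ∧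
      z ^ n ∈ (⊤ : Subgroup H).lowerCentralSeries i := by
    intro i z
    induction i with
    | zero => exact ⟨1, one_pos, Subgroup.mem_top _⟩
    | succ i ih =>
      obtain ⟨n, hn, h⟩ := ih
      obtain ⟨k, hk, h'⟩ := hstep i _ h
      exact ⟨n * k, Nat.mul_pos hn hk, by rwa [pow_mul]⟩
  have hmem : x * y ∈ H := mul_mem (Subgroup.subset_closure (by simp))
    (Subgroup.subset_closure (by simp))
  obtain ⟨n, hn, h⟩ := hall c ⟨x * y, hmem⟩
  rw [hH, Subgroup.mem_bot] at h
  exact isOfFinOrder_iff_pow_eq_one.2 ⟨n, hn, congrArg Subtype.val h⟩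

/-- The rational lower central series: the `m`-th term is the root set
`√(Γ_m K) = {x | x ^ i ∈ Γ_m K for some i ≥ 1}`. -/
def rationalLowerCentral (K : Type*) [Group K] (m : ℕ) : Subgroup K where
  carrier := {x | ∃ i : ℕ, 1 ≤ i ∧ x ^ i ∈ lowerCentral K m}
  one_mem' := ⟨1, le_rfl, by simp⟩
  inv_mem' := by
    rintro x ⟨i, hi, hx⟩
    exact ⟨i, hi, by simpa using hx⟩
  mul_mem' := by
    rintro x y ⟨i, hi, hx⟩ ⟨j, hj, hy⟩
    cases m with
    | zero => exact ⟨1, le_rfl, Subgroup.mem_top _⟩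
    | succ m =>
      have := lowerCentral_characteristic K (m + 1)
      have fin : ∀ z : K, IsOfFinOrder (z : K ⧸ lowerCentral K (m + 1)) ↔
          ∃ n : ℕ, 1 ≤ n ∧ z ^ n ∈ lowerCentral K (m + 1) := by
        intro z
        simp only [isOfFinOrder_iff_pow_eq_one, ← QuotientGroup.mk_pow, QuotientGroup.eq_one_iff]
        rfl
      have hc : (⊤ : Subgroup (K ⧸ lowerCentral K (m + 1))).lowerCentralSeries m = ⊥ := by
        rw [← Subgroup.map_top_of_surjective _ (QuotientGroup.mk'_surjective
          (lowerCentral K (m + 1))), ← Subgroup.map_lowerCentralSeries, ← lowerCentral_succ,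
          QuotientGroup.map_mk'_self]
      have := isOfFinOrder_mul_of_nilpotent m hc ((fin x).2 ⟨i, hi, hx⟩) ((fin y).2 ⟨j, hj, hy⟩)
      rw [← QuotientGroup.mk_mul] at this
      exact (fin _).1 this

/-- The subgroup `H ^ n` generated by all `n`-th powers of elements of `H`. -/
def powSubgroup {K : Type*} [Group K] (H : Subgroup K) (n : ℕ) : Subgroup K :=
  Subgroup.closure {x | ∃ h ∈ H, h ^ n = x}

/-- The Zassenhaus mod-`p` lower central series: the `m`-th term is the product of the (normal)
subgroups `(Γ_i K) ^ (p ^ j)` over all `i ≥ 1`, `j ≥ 0` with `i * p ^ j ≥ m`. -/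
def zassenhaus (p : ℕ) (K : Type*) [Group K] (m : ℕ) : Subgroup K :=
  ⨆ (i : ℕ) (j : ℕ) (_ : 1 ≤ i) (_ : m ≤ i * p ^ j), powSubgroup (lowerCentral K i) (p ^ j)

/-- The Stallings mod-`p` lower central series (lower exponent-`p` central series): term `1` is `K`
and term `m + 1` is the product of the (normal) subgroups `(term m) ^ p` and `[K, term m]` for
`m ≥ 1`; extended by `K` in degree `0`. -/
def stallings (p : ℕ) (K : Type*) [Group K] : ℕ → Subgroup K
  | 0 => ⊤
  | 1 => ⊤
  | m + 2 => powSubgroup (stallings p K (m + 1)) p ⊔ ⁅(⊤ : Subgroup K), stallings p K (m + 1)⁆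

/-- The series `S` of `K` is the lower central series, the rational lower central series, or for
some prime `p` the Zassenhaus or the Stallings mod-`p` lower central series of `K`. -/
inductive IsLowerCentralVariant {K : Type*} [Group K] : (ℕ → Subgroup K) → Prop
  | lowerCentral : IsLowerCentralVariant (lowerCentral K)
  | rational : IsLowerCentralVariant (rationalLowerCentral K)
  | zassenhaus (p : ℕ) (hp : p.Prime) : IsLowerCentralVariant (zassenhaus p K)
  | stallings (p : ℕ) (hp : p.Prime) : IsLowerCentralVariant (stallings p K)

theorem powSubgroup_map_le {K : Type*} [Group K] {H : Subgroup K} (hH : H.Characteristic) (n : ℕ)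
    (f : K ≃* K) : (powSubgroup H n).map f.toMonoidHom ≤ powSubgroup H n := by
  unfold powSubgroup
  rw [Subgroup.map_le_iff_le_comap, Subgroup.closure_le]
  rintro _ ⟨h, hh, rfl⟩
  refine Subgroup.subset_closure ⟨f h, ?_, by simp⟩
  exact Subgroup.characteristic_iff_map_le.1 hH f ⟨h, hh, rfl⟩

theorem IsLowerCentralVariant.characteristic {K : Type*} [Group K] {S : ℕ → Subgroup K}
    (hS : IsLowerCentralVariant S) (m : ℕ) : (S m).Characteristic := by
  cases hS with
  | lowerCentral => exact lowerCentral_characteristic K m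
  | rational =>
    rw [Subgroup.characteristic_iff_map_le]
    rintro f _ ⟨x, ⟨i, hi, hx⟩, rfl⟩
    refine ⟨i, hi, ?_⟩
    rw [← map_pow]
    exact Subgroup.characteristic_iff_map_le.1 (lowerCentral_characteristic K m) f ⟨_, hx, rfl⟩
  | zassenhaus p hp =>
    rw [Subgroup.characteristic_iff_map_le]
    intro f
    simp only [NSeries.zassenhaus, Subgroup.map_iSup]
    gcongr
    exact powSubgroup_map_le (lowerCentral_characteristic K _) _ f
  | stallings p hp =>
    induction m with
    | zero => exact Subgroup.topCharacteristic
    | succ m ih =>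
      cases m with
      | zero => exact Subgroup.topCharacteristic
      | succ m =>
        rw [Subgroup.characteristic_iff_map_le]
        intro f
        simp only [NSeries.stallings, Subgroup.map_sup]
        refine sup_le_sup (powSubgroup_map_le ih _ f) ?_
        exact Subgroup.characteristic_iff_map_le.1 inferInstance f

theorem IsLowerCentralVariant.normal {K : Type*} [Group K] {S : ℕ → Subgroup K}
    (hS : IsLowerCentralVariant S) (m : ℕ) : (S m).Normal :=
  haveI := hS.characteristic m
  inferInstance

/-- Every action of a group `G` on `K` is an action on each of these series. -/
theorem IsLowerCentralVariant.actsOn {K : Type*} [Group K] {S : ℕ → Subgroup K}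
    (hS : IsLowerCentralVariant S) (G : Type*) [Group G] [MulDistribMulAction G K] :
    ActsOn G S :=
  fun _ m => Subgroup.characteristic_iff_map_eq.1 (hS.characteristic m) _

end NSeries

namespace NSeries

open scoped commutatorElement

/-! ### Basic properties of extended N-series -/

section Basic

variable {K : Type*} [Group K]

/-! Since `S 1 = ⊤`, the case `n = 1` of the Johnson condition is exactly membership in the kernel
filtration. The content is the converse: if `g` moves every element of `K` only by `S (m + 1)`, then
it moves `S n` only by `S (m + n)`. Elements fixed by `g` modulo a normal subgroup form a subgroup
(`fixedMod`), so generators of `S n` suffice.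

On `Γ_n` this is an induction on `n`, valid for any extended N-series with `S 1 = ⊤`, by expanding
the commutator of the moved elements (`smul_commutator_mem`). The other series add roots or powers.
Rational: roots are unique in the torsion-free nilpotent quotients. Stallings: the displacement of
`x` is central one level further down, so `p`-th powers multiply. Zassenhaus: one needs `(u * x) ^ p
≡ x ^ p` modulo `S (m + p * i)` for `u ∈ S (m + i)` and `x ∈ S i`.

The Zassenhaus estimates all rest on polynomial maps in the sense of Lazard and Leibman. Such a map
is a product of powers `c ^ (A.choose r * B.choose t)`, with `c` as deep as the degree `(r, t)`
predicts; divisibility of binomial coefficients by powers of `p` supplies the missing depth.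

Finally, the Johnson filtration of an extended N-series is itself one, and this passes to the kernel
filtration through the equality. -/

theorem IsExtendedNSeries.normal {S : ℕ → Subgroup K} (hS : IsExtendedNSeries S) (n : ℕ) :
    (S n).Normal := by
  refine ⟨fun x hx g => ?_⟩
  have h : ⁅g, x⁆ ∈ S (0 + n) := hS.commutator_le 0 n
    (Subgroup.commutator_mem_commutator (hS.zero ▸ Subgroup.mem_top g) hx)
  rw [zero_add] at h
  simpa [commutatorElement_def] using mul_mem h hx

theorem IsExtendedNSeries.commutator_mem {S : ℕ → Subgroup K} (hS : IsExtendedNSeries S)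
    {m n : ℕ} {x y : K} (hx : x ∈ S m) (hy : y ∈ S n) : ⁅x, y⁆ ∈ S (m + n) :=
  hS.commutator_le m n (Subgroup.commutator_mem_commutator hx hy)

end Basic

/-! ### Polynomial maps into a filtered group -/

section Polynomial

variable {K M ι : Type*} [Group K]

/-- The multiplicative difference of `f` along the self-map `τ`. -/
def diff (τ : M → M) (f : M → K) : M → K := fun v => (f v)⁻¹ * f (τ v)

/-- `f` has degree of filtration at least `s`, up to order `d`: each difference along `τ e` raises
the filtration by `w e`, for up to `d` successive differences. -/
def IsPoly (S : ℕ → Subgroup K) (τ : ι → M → M) (w : ι → ℕ) : ℕ → ℕ → (M → K) → Prop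
  | 0, s, f => ∀ v, f v ∈ S s
  | d + 1, s, f => (∀ v, f v ∈ S s) ∧ ∀ e, IsPoly S τ w d (s + w e) (diff (τ e) f)

variable {S : ℕ → Subgroup K} {τ : ι → M → M} {w : ι → ℕ}

theorem IsPoly.apply_mem {d s : ℕ} {f : M → K} (h : IsPoly S τ w d s f) (v : M) : f v ∈ S s := by
  cases d with
  | zero => exact h v
  | succ d => exact h.1 v

theorem IsPoly.mono (hS : IsExtendedNSeries S) {d s t : ℕ} (hts : t ≤ s) {f : M → K}
    (h : IsPoly S τ w d s f) : IsPoly S τ w d t f := by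
  induction d generalizing s t f with
  | zero => exact fun v => hS.antitone hts (h v)
  | succ d ih => exact ⟨fun v => hS.antitone hts (h.1 v), fun e => ih (by lia) (h.2 e)⟩

theorem IsPoly.of_succ {d s : ℕ} {f : M → K} (h : IsPoly S τ w (d + 1) s f) :
    IsPoly S τ w d s f := by
  induction d generalizing s f with
  | zero => exact h.1
  | succ d ih => exact ⟨h.1, fun e => ih (h.2 e)⟩

theorem isPoly_one (d s : ℕ) : IsPoly S τ w d s (1 : M → K) := by
  induction d generalizing s with
  | zero => exact fun v => one_mem _
  | succ d ih =>
    refine ⟨fun v => one_mem _, fun e => ?_⟩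
    convert ih (s + w e)
    ext v
    simp [diff]

/-- The theorem of Lazard and Leibman: polynomial maps are closed under products and inverses,
and commutators add filtration degrees. -/
theorem IsPoly.mul_inv_commutator (hS : IsExtendedNSeries S) (d : ℕ) :
    (∀ (s : ℕ) (f g : M → K), IsPoly S τ w d s f → IsPoly S τ w d s g →
      IsPoly S τ w d s (f * g)) ∧
    (∀ (s : ℕ) (f : M → K), IsPoly S τ w d s f → IsPoly S τ w d s f⁻¹) ∧
    (∀ (s t : ℕ) (f g : M → K), IsPoly S τ w d s f → IsPoly S τ w d t g →
      IsPoly S τ w d (s + t) ⁅f, g⁆) := by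
  induction d with
  | zero =>
    exact ⟨fun s f g hf hg v => mul_mem (hf v) (hg v), fun s f hf v => inv_mem (hf v),
      fun s t f g hf hg v => hS.commutator_mem (hf v) (hg v)⟩
  | succ d ih =>
    obtain ⟨hmul, hinv, hcomm⟩ := ih
    -- Conjugation is a commutator times the original map, so it keeps the degree. It is needed
    -- because the difference of `f * g` is `g⁻¹ * ∂f * g * ∂g`, and that of `f⁻¹` is `f * (∂f)⁻¹ *
    -- f⁻¹`.
    have hconj : ∀ (s t : ℕ) (f g : M → K), IsPoly S τ w d s f → IsPoly S τ w d t g →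
        IsPoly S τ w d t (f * g * f⁻¹) := by
      intro s t f g hf hg
      have h := hmul t _ _ ((hcomm s t f g hf hg).mono hS (by lia)) hg
      rwa [commutatorElement_def, inv_mul_cancel_right] at h
    refine ⟨fun s f g hf hg => ⟨fun v => mul_mem (hf.1 v) (hg.1 v), fun e => ?_⟩,
      fun s f hf => ⟨fun v => inv_mem (hf.1 v), fun e => ?_⟩,
      fun s t f g hf hg => ⟨fun v => hS.commutator_mem (hf.1 v) (hg.1 v), fun e => ?_⟩⟩
    · have h := hmul _ _ _ (hconj _ _ _ _ (hinv _ _ hg.of_succ) (hf.2 e)) (hg.2 e)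
      convert h using 1
      ext v
      simp [diff, mul_assoc]
    · have h := hconj _ _ _ _ hf.of_succ (hinv _ _ (hf.2 e))
      convert h using 1
      ext v
      simp [diff, mul_assoc]
    · have hf0 := hf.of_succ
      have hg0 := hg.of_succ
      -- With `h = g * ∂g`, the difference of `⁅f, g⁆` is `⁅f, g⁆⁻¹ * (f * ⁅∂f, h⁆ * f⁻¹) * ⁅f, g⁆ *
      -- (g * ⁅f, ∂g⁆ * g⁻¹)`.
      have hgb : IsPoly S τ w d t (g * diff (τ e) g) :=
        hmul _ _ _ hg0 ((hg.2 e).mono hS (by lia))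
      have h1 := hconj _ _ _ _ (hinv _ _ (hcomm _ _ _ _ hf0 hg0))
        (hconj _ _ _ _ hf0 (hcomm _ _ _ _ (hf.2 e) hgb))
      have h2 := hconj _ _ _ _ hg0 (hcomm _ _ _ _ hf0 (hg.2 e))
      have h := hmul (s + t + w e) _ _ (h1.mono hS (by lia)) (h2.mono hS (by lia))
      convert h using 1
      ext v
      simp only [diff, commutatorElement_def, Pi.mul_apply, Pi.inv_apply]
      group

theorem IsPoly.mul (hS : IsExtendedNSeries S) {d s : ℕ} {f g : M → K} (hf : IsPoly S τ w d s f)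
    (hg : IsPoly S τ w d s g) : IsPoly S τ w d s (f * g) :=
  (IsPoly.mul_inv_commutator hS d).1 s f g hf hg

theorem IsPoly.inv (hS : IsExtendedNSeries S) {d s : ℕ} {f : M → K} (hf : IsPoly S τ w d s f) :
    IsPoly S τ w d s f⁻¹ :=
  (IsPoly.mul_inv_commutator hS d).2.1 s f hf

theorem IsPoly.commutator (hS : IsExtendedNSeries S) {d s t : ℕ} {f g : M → K}
    (hf : IsPoly S τ w d s f) (hg : IsPoly S τ w d t g) : IsPoly S τ w d (s + t) ⁅f, g⁆ :=
  (IsPoly.mul_inv_commutator hS d).2.2 s t f g hf hg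

end Polynomial

/-! ### Polynomial maps in two variables -/

section TwoVariables

variable {K : Type*} [Group K] {S : ℕ → Subgroup K}

/-- Polynomial maps `ℕ × ℕ → K` for which differences in the two variables raise the filtration
by `i` and by `k`. -/
def IsPoly₂ (S : ℕ → Subgroup K) (i k s : ℕ) (f : ℕ × ℕ → K) : Prop :=
  ∀ d, IsPoly S (fun (e : Bool) (v : ℕ × ℕ) => if e then (v.1 + 1, v.2) else (v.1, v.2 + 1))
    (fun e => if e then i else k) d s f

theorem IsPoly₂.mul (hS : IsExtendedNSeries S) {i k s : ℕ} {f g : ℕ × ℕ → K}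
    (hf : IsPoly₂ S i k s f) (hg : IsPoly₂ S i k s g) : IsPoly₂ S i k s (f * g) :=
  fun d => (hf d).mul hS (hg d)

theorem IsPoly₂.inv (hS : IsExtendedNSeries S) {i k s : ℕ} {f : ℕ × ℕ → K}
    (hf : IsPoly₂ S i k s f) : IsPoly₂ S i k s f⁻¹ :=
  fun d => (hf d).inv hS

theorem IsPoly₂.commutator (hS : IsExtendedNSeries S) {i k s t : ℕ} {f g : ℕ × ℕ → K}
    (hf : IsPoly₂ S i k s f) (hg : IsPoly₂ S i k t g) : IsPoly₂ S i k (s + t) ⁅f, g⁆ :=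
  fun d => (hf d).commutator hS (hg d)

/-- By Pascal's rule a difference lowers `r` or `t` by one while `s` grows by `i` or `k`, so the
required depth `s + r * i + t * k` of `c` does not change. These are the monomials of the Taylor
expansion. -/
theorem isPoly₂_pow_choose (hS : IsExtendedNSeries S) {i k s r t : ℕ} {c : K}
    (hc : c ∈ S (s + r * i + t * k)) :
    IsPoly₂ S i k s (fun v => c ^ (v.1.choose r * v.2.choose t)) := by
  intro d
  induction d generalizing s r t with
  | zero => exact fun v => hS.antitone (by lia) (pow_mem hc _)
  | succ d ih =>
    refine ⟨fun v => hS.antitone (by lia) (pow_mem hc _), Bool.forall_bool.2 ⟨?_, ?_⟩⟩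
    · change IsPoly S _ _ d (s + k) (diff (fun v => (v.1, v.2 + 1)) _)
      cases t with
      | zero =>
        convert isPoly_one d (s + k) using 1
        ext v
        simp [diff]
      | succ t =>
        convert ih (s := s + k) (r := r) (t := t) (by convert hc using 2; ring) using 1
        ext v
        simp [diff, Nat.choose_succ_succ, mul_add, inv_mul_eq_iff_eq_mul, ← pow_add, add_comm]
    · change IsPoly S _ _ d (s + i) (diff (fun v => (v.1 + 1, v.2)) _)
      cases r with
      | zero =>
        convert isPoly_one d (s + i) using 1
        ext v
        simp [diff]
      | succ r =>
        convert ih (s := s + i) (r := r) (t := t) (by convert hc using 2; ring) using 1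
        ext v
        simp [diff, Nat.choose_succ_succ, add_mul, inv_mul_eq_iff_eq_mul, ← pow_add, add_comm]

/-- The leading Taylor coefficient of a polynomial map lies in the expected term. -/
theorem IsPoly₂.apply_mem {i k s : ℕ} {f : ℕ × ℕ → K} (hf : IsPoly₂ S i k s f) (r t : ℕ)
    (h : ∀ a b, a ≤ r → b ≤ t → (a, b) ≠ (r, t) → f (a, b) = 1) :
    f (r, t) ∈ S (s + r * i + t * k) := by
  have hdiff : ∀ {s : ℕ} {f : ℕ × ℕ → K}, IsPoly₂ S i k s f →
      IsPoly₂ S i k (s + i) (diff (fun v => (v.1 + 1, v.2)) f) ∧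
      IsPoly₂ S i k (s + k) (diff (fun v => (v.1, v.2 + 1)) f) :=
    fun hf => ⟨fun d => (hf (d + 1)).2 true, fun d => (hf (d + 1)).2 false⟩
  induction r generalizing s f with
  | zero =>
    induction t generalizing s f with
    | zero => simpa using IsPoly.apply_mem (hf 0) (0, 0)
    | succ t ih =>
      -- As `f` is trivial here, its difference at this point is the next value of `f`, to which
      -- induction applies.
      have h1 : f (0, t) = 1 := h 0 t le_rfl (by lia) (by simp)
      have := ih (hdiff hf).2 (by
        intro a b ha hb hab
        have hbt : b ≠ t := by rintro rfl; exact hab (by simp; lia)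
        simp [diff, h a b ha (by lia) (by simp; lia),
          h a (b + 1) ha (by lia) (by simp; lia)])
      simp only [diff, h1, inv_one, one_mul] at this
      convert this using 2
      ring
  | succ r ih =>
    have h1 : f (r, t) = 1 := h r t (by lia) le_rfl (by simp)
    have := ih (hdiff hf).1 (by
      intro a b ha hb hab
      have : a ≠ r ∨ b ≠ t := by
        by_contra! hc
        exact hab (by rw [hc.1, hc.2])
      simp [diff, h a b (by lia) hb (by simp; lia),
        h (a + 1) b (by lia) hb (by simp; lia)])
    simp only [diff, h1, inv_one, one_mul] at this
    convert this using 2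
    ring

/-- The Hall–Petresco principle: the value at `(A, B)` of a polynomial map that vanishes unless
`r₀ ≤ a` and `t₀ ≤ b` is a product of powers `c ^ (A.choose r * B.choose t)` of elements `c` of
the expected terms. -/
theorem IsPoly₂.apply_mem_of_pow_choose_mem (hS : IsExtendedNSeries S) {i k s r₀ t₀ A B : ℕ}
    {T : Subgroup K}
    (hT : ∀ r t, r₀ ≤ r → r ≤ A → t₀ ≤ t → t ≤ B → ∀ c ∈ S (s + r * i + t * k),
      c ^ (A.choose r * B.choose t) ∈ T)
    {f : ℕ × ℕ → K} (hf : IsPoly₂ S i k s f) (h0 : ∀ a b, a < r₀ ∨ b < t₀ → f (a, b) = 1) :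
    f (A, B) ∈ T := by
  -- Cells are cleared row by row: `r` rows are already trivial and `q` bounds those left; `t` and
  -- `q'` below play the same role within row `r`.
  suffices key : ∀ q r (f : ℕ × ℕ → K), A < r + q → IsPoly₂ S i k s f →
      (∀ a b, a < r₀ ∨ b < t₀ → f (a, b) = 1) → (∀ a b, a < r → b ≤ B → f (a, b) = 1) →
      f (A, B) ∈ T from
    key (A + 1) 0 f (by lia) hf h0 (by simp)
  intro q
  induction q with
  | zero =>
    intro r f hA hf h0 h
    rw [h A B (by lia) le_rfl]
    exact one_mem _
  | succ q ih =>
    intro r f hA hf h0 h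
    suffices key : ∀ q' t (f : ℕ × ℕ → K), B < t + q' → IsPoly₂ S i k s f →
        (∀ a b, a < r₀ ∨ b < t₀ → f (a, b) = 1) → (∀ a b, a < r → b ≤ B → f (a, b) = 1) →
        (∀ b, b < t → b ≤ B → f (r, b) = 1) → f (A, B) ∈ T from
      key (B + 1) 0 f (by lia) hf h0 h (by simp)
    have hrow : ∀ f : ℕ × ℕ → K, IsPoly₂ S i k s f → (∀ a b, a < r₀ ∨ b < t₀ → f (a, b) = 1) →
        (∀ a b, a < r → b ≤ B → f (a, b) = 1) → (∀ b, b ≤ B → f (r, b) = 1) → f (A, B) ∈ T := by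
      intro f hf h0 h hr
      refine ih (r + 1) f (by lia) hf h0 fun a b ha hb => ?_
      rcases Nat.lt_succ_iff_lt_or_eq.1 ha with ha | rfl
      · exact h a b ha hb
      · exact hr b hb
    intro q'
    induction q' with
    | zero =>
      intro t f hB hf h0 h hr
      exact hrow f hf h0 h fun b hb => hr b (by lia) hb
    | succ q' ih' =>
      intro t f hB hf h0 h hr
      by_cases hrA : A < r
      · rw [h A B hrA le_rfl]
        exact one_mem _
      by_cases htB : B < t
      · exact hrow f hf h0 h fun b hb => hr b (by lia) hb
      by_cases hrt : f (r, t) = 1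
      · refine ih' (t + 1) f (by lia) hf h0 h fun b hb hbB => ?_
        rcases Nat.lt_succ_iff_lt_or_eq.1 hb with hb | rfl
        · exact hr b hb hbB
        · exact hrt
      have hr0 : r₀ ≤ r := by
        by_contra! hc
        exact hrt (h0 r t (Or.inl hc))
      have ht0 : t₀ ≤ t := by
        by_contra! hc
        exact hrt (h0 r t (Or.inr hc))
      have hc : f (r, t) ∈ S (s + r * i + t * k) := by
        refine hf.apply_mem r t fun a b ha hb hab => ?_
        rcases ha.lt_or_eq with ha | rfl
        · exact h a b ha (by lia)
        · exact hr b (lt_of_le_of_ne hb (by rintro rfl; exact hab rfl)) (by lia)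
      -- The monomial with leading coefficient `f (r, t)` is trivial on all earlier cells, so
      -- dividing by it clears this cell without disturbing them.
      let g : ℕ × ℕ → K := fun v => f (r, t) ^ (v.1.choose r * v.2.choose t)
      have hg : IsPoly₂ S i k s g := isPoly₂_pow_choose hS hc
      have hg1 : ∀ a b, a < r ∨ b < t → g (a, b) = 1 := by
        rintro a b (hab | hab) <;> simp [g, Nat.choose_eq_zero_of_lt hab]
      have hfg := ih' (t + 1) (g⁻¹ * f) (by lia) ((hg.inv hS).mul hS hf)
        (fun a b hab => by simp [hg1 a b (by lia), h0 a b hab])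
        (fun a b ha hb => by simp [hg1 a b (Or.inl ha), h a b ha hb])
        (fun b hb hbB => by
          rcases Nat.lt_succ_iff_lt_or_eq.1 hb with hb | rfl
          · simp [hg1 r b (Or.inr hb), hr b hb hbB]
          · simp [g])
      have := mul_mem (hT r t hr0 (by lia) ht0 (by lia) _ hc) hfg
      simpa [g] using this

end TwoVariables

/-! ### Commutation and group actions modulo a normal subgroup -/

section Modulo

variable {K : Type*} [Group K]

/-- The subgroup of elements that commute with `y` modulo `N`. -/
def centralizerMod (N : Subgroup K) [N.Normal] (y : K) : Subgroup K :=
  (Subgroup.centralizer {(y : K ⧸ N)}).comap (QuotientGroup.mk' N)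

theorem commute_mk_iff {N : Subgroup K} [N.Normal] {x y : K} :
    Commute (x : K ⧸ N) (y : K ⧸ N) ↔ ⁅x, y⁆ ∈ N := by
  rw [← commutatorElement_eq_one_iff_commute, ← QuotientGroup.eq_one_iff]
  exact Iff.of_eq (congrArg (· = 1) (map_commutatorElement (QuotientGroup.mk' N) x y).symm)

theorem mem_centralizerMod {N : Subgroup K} [N.Normal] {x y : K} :
    x ∈ centralizerMod N y ↔ ⁅x, y⁆ ∈ N := by
  rw [← commute_mk_iff, centralizerMod, Subgroup.mem_comap, Subgroup.mem_centralizer_singleton_iff]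
  rfl

theorem mem_centralizerMod_comm {N : Subgroup K} [N.Normal] {x y : K} :
    x ∈ centralizerMod N y ↔ y ∈ centralizerMod N x := by
  rw [mem_centralizerMod, mem_centralizerMod, ← inv_mem_iff, commutatorElement_inv]

/-- The three subgroups lemma modulo a normal subgroup. -/
theorem commutator_commutator_le_of_rotate {H₁ H₂ H₃ N : Subgroup K} [N.Normal]
    (h1 : ⁅⁅H₂, H₃⁆, H₁⁆ ≤ N) (h2 : ⁅⁅H₃, H₁⁆, H₂⁆ ≤ N) : ⁅⁅H₁, H₂⁆, H₃⁆ ≤ N := by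
  have key : ∀ A B C : Subgroup K, ⁅⁅A, B⁆, C⁆ ≤ N ↔
      ⁅⁅A.map (QuotientGroup.mk' N), B.map (QuotientGroup.mk' N)⁆,
        C.map (QuotientGroup.mk' N)⁆ = ⊥ := by
    intro A B C
    rw [← Subgroup.map_commutator, ← Subgroup.map_commutator, Subgroup.map_eq_bot_iff,
      QuotientGroup.ker_mk']
  rw [key] at *
  exact Subgroup.commutator_commutator_eq_bot_of_rotate h1 h2

variable {G : Type*} [Group G] [MulDistribMulAction G K]

/-- The subgroup of elements fixed by `g` modulo `N`. -/
def fixedMod (N : Subgroup K) [N.Normal] (g : G) : Subgroup K :=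
  ((QuotientGroup.mk' N).comp (MulDistribMulAction.toMonoidHom K g)).eqLocus (QuotientGroup.mk' N)

theorem mem_fixedMod {N : Subgroup K} [hN : N.Normal] {g : G} {x : K} :
    x ∈ fixedMod N g ↔ (g • x) * x⁻¹ ∈ N := by
  rw [hN.mem_comm_iff, ← QuotientGroup.eq, eq_comm]
  rfl

end Modulo

/-! ### Extended N-series -/

section Series

variable {K : Type*} [Group K] {S : ℕ → Subgroup K}

/-- When `m` or `n` is `0`, the commutator condition follows from normality alone. -/
theorem IsExtendedNSeries.of_pos (h0 : S 0 = ⊤) (hS : Antitone S) (hN : ∀ n, (S n).Normal)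
    (hc : ∀ m n, ⁅S (m + 1), S (n + 1)⁆ ≤ S (m + 1 + (n + 1))) : IsExtendedNSeries S where
  zero := h0
  antitone := hS
  commutator_le m n := by
    have := hN m
    have := hN n
    cases m with
    | zero =>
      rw [zero_add]
      exact Subgroup.commutator_le_right _ _
    | succ m =>
      cases n with
      | zero => exact Subgroup.commutator_le_left _ _
      | succ n => exact hc m n

theorem lowerCentral_isExtendedNSeries (K : Type*) [Group K] :
    IsExtendedNSeries (lowerCentral K) := by
  have hN : ∀ n, (lowerCentral K n).Normal := fun n =>
    haveI := lowerCentral_characteristic K n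
    inferInstance
  refine IsExtendedNSeries.of_pos rfl (antitone_nat_of_succ_le fun n => ?_) hN fun m => ?_
  · have := hN n
    cases n with
    | zero => exact le_top
    | succ n => exact Subgroup.commutator_le_right _ _
  · induction m with
    | zero =>
      intro n
      rw [show 0 + 1 + (n + 1) = n + 2 by ring]
      exact le_rfl
    | succ m ih =>
      intro n
      have := hN (m + 1 + 1 + (n + 1))
      change ⁅⁅(⊤ : Subgroup K), lowerCentral K (m + 1)⁆, lowerCentral K (n + 1)⁆ ≤ _
      -- The two rotated commutators are covered by the induction hypothesis at `n` and at `n + 1`.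
      refine commutator_commutator_le_of_rotate ?_ ?_
      · rw [Subgroup.commutator_comm]
        refine (Subgroup.commutator_mono le_rfl (ih n)).trans (le_of_eq ?_)
        rw [show m + 1 + 1 + (n + 1) = m + n + 1 + 2 by ring,
          show m + 1 + (n + 1) = m + n + 1 + 1 by ring]
        rfl
      · rw [Subgroup.commutator_comm (lowerCentral K (n + 1)),
          Subgroup.commutator_comm ⁅(⊤ : Subgroup K), lowerCentral K (n + 1)⁆]
        refine (ih (n + 1)).trans (le_of_eq (congrArg _ (by ring)))

theorem lowerCentral_le (hS : IsExtendedNSeries S) (h1 : S 1 = ⊤) (n : ℕ) :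
    lowerCentral K n ≤ S n := by
  cases n with
  | zero => rw [hS.zero]; exact le_top
  | succ n =>
    induction n with
    | zero => rw [h1]; exact le_top
    | succ n ih =>
      have := (Subgroup.commutator_mono h1.ge ih).trans (hS.commutator_le 1 (n + 1))
      rw [add_comm 1] at this
      exact this

variable {G : Type*} [Group G] [MulDistribMulAction G K]

/-- If `g` acts trivially on `a` and `b` modulo the expected terms of an extended N-series, then
so it does on `⁅a, b⁆`. -/
theorem IsExtendedNSeries.smul_commutator_mem (hS : IsExtendedNSeries S)
    (h1 : S 1 = ⊤) {g : G} {m n : ℕ} {a b : K}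
    (hb : b ∈ S n) (hga : (g • a) * a⁻¹ ∈ S (m + 1)) (hgb : (g • b) * b⁻¹ ∈ S (m + n)) :
    (g • ⁅a, b⁆) * ⁅a, b⁆⁻¹ ∈ S (m + (n + 1)) := by
  have hN := hS.normal (m + (n + 1))
  have hNn := hS.normal n
  obtain ⟨u, hu⟩ : ∃ u, (g • a) * a⁻¹ = u := ⟨_, rfl⟩
  obtain ⟨v, hv⟩ : ∃ v, (g • b) * b⁻¹ = v := ⟨_, rfl⟩
  have hvn : v ∈ S n := hS.antitone (by lia) (hv ▸ hgb)
  rw [hu] at hga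
  rw [hv] at hgb
  have hab : ⁅a, b⁆ ∈ S n := Subgroup.commutator_le_right ⊤ (S n)
    (Subgroup.commutator_mem_commutator (Subgroup.mem_top a) hb)
  have huc : ∀ c ∈ S n, ⁅u, c⁆ ∈ S (m + (n + 1)) := fun c hc =>
    hS.antitone (by lia) (hS.commutator_mem hga hc)
  have hav : ⁅a, v⁆ ∈ S (m + (n + 1)) :=
    hS.antitone (by lia) (hS.commutator_mem (h1 ▸ Subgroup.mem_top a : a ∈ S 1) hgb)
  have hvab : ⁅v, ⁅a, b⁆⁆ ∈ S (m + (n + 1)) := by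
    rw [← inv_mem_iff, commutatorElement_inv]
    exact hS.antitone (by lia)
      (hS.commutator_mem (h1 ▸ Subgroup.mem_top ⁅a, b⁆ : ⁅a, b⁆ ∈ S 1) hgb)
  -- Expansion of `⁅u * a, v * b⁆ * ⁅a, b⁆⁻¹`. Commutators of `u ∈ S (m + 1)` with `S n`, and of `v
  -- ∈ S (m + n)` with `K = S 1`, all have depth `m + n + 1`.
  have e : (g • ⁅a, b⁆) * ⁅a, b⁆⁻¹ =
      u * ⁅a, v⁆ * u⁻¹ * (u * ⁅v, ⁅a, b⁆⁆ * u⁻¹) * ⁅u, ⁅a, b⁆⁆ *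
        (⁅a, b⁆ * ⁅u, v * b⁆ * ⁅a, b⁆⁻¹) := by
    have hga' : g • a = u * a := by rw [← hu, inv_mul_cancel_right]
    have hgb' : g • b = v * b := by rw [← hv, inv_mul_cancel_right]
    simp only [commutatorElement_def, smul_mul', smul_inv', hga', hgb']
    group
  rw [e]
  exact mul_mem (mul_mem (mul_mem (hN.conj_mem _ hav _) (hN.conj_mem _ hvab _)) (huc _ hab))
    (hN.conj_mem _ (huc _ (mul_mem hvn hb)) _)

/-- If `g` acts trivially on `K` modulo `S (m + 1)`, then it acts trivially on the `n`-th term of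
the lower central series modulo `S (m + n)`. -/
theorem smul_mul_inv_mem_of_mem_lowerCentral (hS : IsExtendedNSeries S) (h1 : S 1 = ⊤) {g : G}
    {m : ℕ} (hg : ∀ k : K, (g • k) * k⁻¹ ∈ S (m + 1)) {n : ℕ} {x : K}
    (hx : x ∈ lowerCentral K n) : (g • x) * x⁻¹ ∈ S (m + n) := by
  cases n with
  | zero => exact hS.antitone (by lia) (hg x)
  | succ n =>
    induction n generalizing x with
    | zero => exact hg x
    | succ n ih =>
      have hN := hS.normal (m + (n + 1 + 1))
      rw [← mem_fixedMod]
      suffices h : ⁅(⊤ : Subgroup K), lowerCentral K (n + 1)⁆ ≤ fixedMod _ g from h hx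
      rw [Subgroup.commutator_le]
      intro a _ b hb
      rw [mem_fixedMod]
      exact hS.smul_commutator_mem h1 (lowerCentral_le hS h1 _ hb) (hg a) (ih hb)

end Series

/-! ### The Johnson filtration -/

section Johnson

variable {K G : Type*} [Group K] [Group G] [MulDistribMulAction G K] {S : ℕ → Subgroup K}

theorem johnsonFiltration_isExtendedNSeries (hS : IsExtendedNSeries S) (h : ActsOn G S) :
    IsExtendedNSeries (johnsonFiltration S h) where
  zero := by
    rw [eq_top_iff]
    intro g _ n k hk
    rw [zero_add]
    exact mul_mem (h.smul_mem g hk) (inv_mem hk)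
  antitone := fun a b hab g hg n k hk => hS.antitone (by lia) (hg n k hk)
  commutator_le a b := by
    rw [Subgroup.commutator_le]
    intro g hg f hf n x hx
    -- Writing `x = f • g • k` turns the displacement by `⁅g, f⁆` into a comparison of `g • f • k`
    -- with `f • g • k`.
    obtain ⟨k, rfl⟩ : ∃ k, f • g • k = x := ⟨g⁻¹ • f⁻¹ • x, by simp⟩
    have hk : k ∈ S n := by simpa using h.smul_mem g⁻¹ (h.smul_mem f⁻¹ hx)
    obtain ⟨u, hu⟩ : ∃ u, (g • k) * k⁻¹ = u := ⟨_, rfl⟩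
    obtain ⟨v, hv⟩ : ∃ v, (f • k) * k⁻¹ = v := ⟨_, rfl⟩
    have hun : u ∈ S (a + n) := hu ▸ hg n k hk
    have hvn : v ∈ S (b + n) := hv ▸ hf n k hk
    have hgv : (g • v) * v⁻¹ ∈ S (a + b + n) := hS.antitone (by lia) (hg _ v hvn)
    have hfu : (f • u) * u⁻¹ ∈ S (a + b + n) := hS.antitone (by lia) (hf _ u hun)
    have huv : ⁅v, u⁆ ∈ S (a + b + n) := hS.antitone (by lia) (hS.commutator_mem hvn hun)
    have hgk : g • k = u * k := by rw [← hu, inv_mul_cancel_right]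
    have hfk : f • k = v * k := by rw [← hv, inv_mul_cancel_right]
    have e : (⁅g, f⁆ • f • g • k) * (f • g • k)⁻¹ =
        (g • v) * v⁻¹ * ⁅v, u⁆ * ((f • u) * u⁻¹)⁻¹ := by
      have e1 : ⁅g, f⁆ • f • g • k = g • f • k := by
        simp only [commutatorElement_def, smul_smul]
        congr 1
        group
      rw [e1, hgk, hfk, smul_mul', smul_mul', hgk, hfk, commutatorElement_def]
      group
    rw [e]
    exact mul_mem (mul_mem hgv huv) (inv_mem hfu)

theorem johnsonFiltration_eq_kernelFiltration (hS : IsExtendedNSeries S)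
    (hN : ∀ n, (S n).Normal) (h : ActsOn G S) (m : ℕ) (h1 : S 1 = ⊤)
    (hpos : ∀ g : G, (∀ k : K, (g • k) * k⁻¹ ∈ S (m + 1)) →
      ∀ n, ∀ x ∈ S (n + 1), (g • x) * x⁻¹ ∈ S (m + (n + 1))) :
    johnsonFiltration S h m = kernelFiltration S hN h m := by
  ext g
  rw [mem_kernelFiltration_iff]
  constructor
  · intro hg k
    exact hg 1 k (h1 ▸ Subgroup.mem_top k)
  · intro hg n x hx
    cases n with
    | zero => exact hS.antitone (by lia) (hg x)
    | succ n => exact hpos g hg n x hx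

end Johnson

/-! ### The rational lower central series -/

section Rational

variable {K : Type*} [Group K]

/-- Roots are unique in the image of a homomorphism to a torsion-free group that kills a term of
the lower central series. -/
theorem map_eq_of_map_pow_eq {Q : Type*} [Group Q]
    (hQ : ∀ (q : Q) (i : ℕ), 1 ≤ i → q ^ i = 1 → q = 1)
    (f : K →* Q) {M : ℕ} (hf : ∀ x ∈ lowerCentral K M, f x = 1) {i : ℕ} (hi : 1 ≤ i) {t z : K}
    (h : f t ^ i = f z ^ i) : f t = f z := by
  have hS := lowerCentral_isExtendedNSeries K
  suffices key : ∀ d k (t : K), M ≤ k + d → t * z⁻¹ ∈ lowerCentral K k →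
      f t ^ i = f z ^ i → f t = f z from
    key M 0 t (by lia) (Subgroup.mem_top _) h
  intro d
  induction d with
  | zero =>
    intro k t hk ht _
    have := hf _ (hS.antitone hk ht)
    rwa [map_mul, map_inv, mul_inv_eq_one] at this
  | succ d ih =>
    intro k t hk ht h
    -- The conjugate is another root of the same power, and it differs from `z` by `⁅t * z⁻¹, z⁆`,
    -- one level deeper. Hence `f t` and `f z` commute, and torsion-freeness applies to their
    -- quotient.
    have hz : f (t * z * t⁻¹) = f z := by
      refine ih (k + 1) _ (by lia) ?_ ?_
      · have := hS.commutator_mem ht (show z ∈ lowerCentral K 1 from Subgroup.mem_top z)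
        convert this using 1
        simp only [commutatorElement_def]
        group
      · rw [map_mul, map_mul, map_inv, conj_pow, ← h, (Commute.refl (f t)).pow_right i |>.eq,
          mul_inv_cancel_right]
    rw [map_mul, map_mul, map_inv, mul_inv_eq_iff_eq_mul] at hz
    have hc : Commute (f t) (f z)⁻¹ := Commute.inv_right hz
    have := hQ (f t * (f z)⁻¹) i hi (by rw [hc.mul_pow, inv_pow, h, mul_inv_cancel])
    rwa [mul_inv_eq_one] at this

theorem lowerCentral_le_rationalLowerCentral (n : ℕ) :
    lowerCentral K n ≤ rationalLowerCentral K n :=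
  fun x hx => ⟨1, le_rfl, by simpa using hx⟩

theorem eq_one_of_pow_eq_one_rationalLowerCentral (M : ℕ) [(rationalLowerCentral K M).Normal]
    (q : K ⧸ rationalLowerCentral K M) (i : ℕ) (hi : 1 ≤ i) (h : q ^ i = 1) : q = 1 := by
  induction q using QuotientGroup.induction_on with
  | H x =>
    rw [← QuotientGroup.mk_pow, QuotientGroup.eq_one_iff] at h
    obtain ⟨j, hj, hx⟩ := h
    exact (QuotientGroup.eq_one_iff _).2
      ⟨i * j, Nat.mul_pos hi hj, by rwa [pow_mul]⟩

theorem mk_eq_mk_of_pow_eq_pow_rationalLowerCentral {M : ℕ} [(rationalLowerCentral K M).Normal]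
    {i : ℕ} (hi : 1 ≤ i) {t z : K}
    (h : (t : K ⧸ rationalLowerCentral K M) ^ i = (z : K ⧸ rationalLowerCentral K M) ^ i) :
    (t : K ⧸ rationalLowerCentral K M) = z :=
  map_eq_of_map_pow_eq (eq_one_of_pow_eq_one_rationalLowerCentral M) (QuotientGroup.mk' _)
    (fun x hx => (QuotientGroup.eq_one_iff x).2 (lowerCentral_le_rationalLowerCentral M hx)) hi h

/-- If `x ^ i` commutes with `y` in the quotient, then `x` and `y * x * y⁻¹` have the same `i`-th
power there, so unique roots make them equal. -/
theorem commutator_mem_of_pow_commutator_mem_rationalLowerCentral {M i : ℕ} (hi : 1 ≤ i) {x y : K}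
    (h : ⁅x ^ i, y⁆ ∈ rationalLowerCentral K M) : ⁅x, y⁆ ∈ rationalLowerCentral K M := by
  have := (IsLowerCentralVariant.rational (K := K)).normal M
  rw [← inv_mem_iff, commutatorElement_inv, ← commute_mk_iff] at *
  have e := mk_eq_mk_of_pow_eq_pow_rationalLowerCentral (M := M) hi (t := y * x * y⁻¹) (z := x) (by
    rw [QuotientGroup.mk_pow] at h
    rw [QuotientGroup.mk_mul, QuotientGroup.mk_mul, QuotientGroup.mk_inv, conj_pow, h.eq,
      mul_inv_cancel_right])
  rwa [QuotientGroup.mk_mul, QuotientGroup.mk_mul, QuotientGroup.mk_inv,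
    mul_inv_eq_iff_eq_mul] at e

theorem rationalLowerCentral_isExtendedNSeries (K : Type*) [Group K] :
    IsExtendedNSeries (rationalLowerCentral K) where
  zero := eq_top_iff.2 fun x _ => ⟨1, le_rfl, Subgroup.mem_top _⟩
  antitone := fun a b hab x ⟨i, hi, hx⟩ =>
    ⟨i, hi, (lowerCentral_isExtendedNSeries K).antitone hab hx⟩
  commutator_le m n := by
    rw [Subgroup.commutator_le]
    rintro x ⟨i, hi, hx⟩ y ⟨j, hj, hy⟩
    refine commutator_mem_of_pow_commutator_mem_rationalLowerCentral hi ?_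
    rw [← inv_mem_iff, commutatorElement_inv]
    refine commutator_mem_of_pow_commutator_mem_rationalLowerCentral hj ?_
    rw [← inv_mem_iff, commutatorElement_inv]
    exact lowerCentral_le_rationalLowerCentral _
      ((lowerCentral_isExtendedNSeries K).commutator_mem hx hy)

theorem rationalLowerCentral_one (K : Type*) [Group K] : rationalLowerCentral K 1 = ⊤ :=
  eq_top_iff.2 fun _ _ => ⟨1, le_rfl, Subgroup.mem_top _⟩

theorem smul_mul_inv_mem_rationalLowerCentral {G : Type*} [Group G] [MulDistribMulAction G K]
    {g : G} {m : ℕ} (hg : ∀ k : K, (g • k) * k⁻¹ ∈ rationalLowerCentral K (m + 1)) {n : ℕ} {x : K}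
    (hx : x ∈ rationalLowerCentral K n) : (g • x) * x⁻¹ ∈ rationalLowerCentral K (m + n) := by
  obtain ⟨i, hi, hx⟩ := hx
  have hN := (IsLowerCentralVariant.rational (K := K)).normal (m + n)
  have h := smul_mul_inv_mem_of_mem_lowerCentral (rationalLowerCentral_isExtendedNSeries K)
    (rationalLowerCentral_one K) hg hx
  rw [hN.mem_comm_iff, ← QuotientGroup.eq] at h ⊢
  refine (mk_eq_mk_of_pow_eq_pow_rationalLowerCentral hi ?_).symm
  rw [← QuotientGroup.mk_pow, ← QuotientGroup.mk_pow, h, smul_pow']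

end Rational

/-! ### The Stallings series -/

section Stallings

variable {K : Type*} [Group K]

theorem pow_mem_powSubgroup {H : Subgroup K} {x : K} (hx : x ∈ H) (n : ℕ) :
    x ^ n ∈ powSubgroup H n :=
  Subgroup.subset_closure ⟨x, hx, rfl⟩

theorem powSubgroup_le_iff {H L : Subgroup K} {n : ℕ} :
    powSubgroup H n ≤ L ↔ ∀ x ∈ H, x ^ n ∈ L := by
  rw [powSubgroup, Subgroup.closure_le]
  constructor
  · exact fun h x hx => h ⟨x, hx, rfl⟩
  · rintro h _ ⟨x, hx, rfl⟩
    exact h x hx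

theorem pow_mem_stallings {p n : ℕ} {x : K} (hx : x ∈ stallings p K (n + 1)) :
    x ^ p ∈ stallings p K (n + 2) :=
  (le_sup_left : _ ≤ stallings p K (n + 2)) (pow_mem_powSubgroup hx p)

theorem stallings_isExtendedNSeries {p : ℕ} (hp : p.Prime) (K : Type*) [Group K] :
    IsExtendedNSeries (stallings p K) := by
  have hN := (IsLowerCentralVariant.stallings (K := K) p hp).normal
  have hcomm : ∀ {n : ℕ} {a x : K}, x ∈ stallings p K (n + 1) → ⁅a, x⁆ ∈ stallings p K (n + 2) :=
    fun hx => (le_sup_right : _ ≤ stallings p K (_ + 2))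
      (Subgroup.commutator_mem_commutator (Subgroup.mem_top _) hx)
  refine IsExtendedNSeries.of_pos rfl (antitone_nat_of_succ_le fun n => ?_) hN fun m n => ?_
  · have := hN n
    cases n with
    | zero => exact le_top
    | succ n =>
      exact sup_le (powSubgroup_le_iff.2 fun x hx => pow_mem hx _)
        (Subgroup.commutator_le_right _ _)
  · induction n generalizing m with
    | zero =>
      rw [Subgroup.commutator_comm]
      exact le_sup_right
    | succ n ih =>
      have hNN := hN (m + 1 + (n + 1 + 1))
      rw [Subgroup.commutator_comm]
      suffices h : ∀ y ∈ stallings p K (m + 1), stallings p K (n + 2) ≤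
          centralizerMod (stallings p K (m + 1 + (n + 1 + 1))) y from
        (Subgroup.commutator_le).2 fun x hx y hy => mem_centralizerMod.1 (h y hy hx)
      intro y hy
      refine sup_le (powSubgroup_le_iff.2 fun x hx => ?_) ?_
      · have hyx : ⁅x, y⁆ ∈ stallings p K (m + 1 + n + 1) := by
          rw [← inv_mem_iff, commutatorElement_inv]
          exact ih m (Subgroup.commutator_mem_commutator hy hx)
        have hc : Commute (x : K ⧸ stallings p K (m + 1 + n + 2))
            (⁅x, y⁆ : K) := commute_mk_iff.2 (hcomm hyx)
        have hm : ((⁅x, y⁆ : K) : K ⧸ stallings p K (m + 1 + n + 2)) =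
            ⁅(x : K ⧸ stallings p K (m + 1 + n + 2)), (y : K ⧸ _)⁆ :=
          map_commutatorElement (QuotientGroup.mk' _) x y
        rw [mem_centralizerMod, ← commute_mk_iff]
        change Commute ((x ^ p : K) : K ⧸ stallings p K (m + 1 + n + 2)) y
        rw [hm] at hc
        rw [← commutatorElement_eq_one_iff_commute, QuotientGroup.mk_pow,
          commutatorElement_pow_of_commute hc, ← hm, ← QuotientGroup.mk_pow,
          QuotientGroup.eq_one_iff]
        exact pow_mem_stallings hyx
      · intro x hx
        rw [mem_centralizerMod]
        refine commutator_commutator_le_of_rotate (H₁ := ⊤) (H₂ := stallings p K (n + 1))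
          (H₃ := stallings p K (m + 1)) ?_ ?_ (Subgroup.commutator_mem_commutator hx hy)
        · rw [Subgroup.commutator_comm, Subgroup.commutator_comm (stallings p K (n + 1))]
          exact (Subgroup.commutator_mono le_rfl (ih m)).trans le_sup_right
        · rw [Subgroup.commutator_comm (stallings p K (m + 1))]
          refine (Subgroup.commutator_mono le_sup_right le_rfl).trans
            ((ih (m + 1)).trans (le_of_eq (congrArg _ (by ring))))

theorem smul_mul_inv_mem_stallings {p : ℕ} (hp : p.Prime) {G : Type*} [Group G]
    [MulDistribMulAction G K] {g : G} {m : ℕ}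
    (hg : ∀ k : K, (g • k) * k⁻¹ ∈ stallings p K (m + 1)) (n : ℕ) :
    ∀ x ∈ stallings p K (n + 1), (g • x) * x⁻¹ ∈ stallings p K (m + (n + 1)) := by
  have hS := stallings_isExtendedNSeries hp K
  induction n with
  | zero => exact fun x _ => hg x
  | succ n ih =>
    have hN := hS.normal (m + (n + 1 + 1))
    suffices h : stallings p K (n + 2) ≤ fixedMod (stallings p K (m + (n + 1 + 1))) g from
      fun x hx => mem_fixedMod.1 (h hx)
    refine sup_le (powSubgroup_le_iff.2 fun x hx => ?_) ((Subgroup.commutator_le).2 ?_)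
    · obtain ⟨u, hu⟩ : ∃ u, (g • x) * x⁻¹ = u := ⟨_, rfl⟩
      have hum : u ∈ stallings p K (m + n + 1) := hu ▸ ih x hx
      have hgx : g • x = u * x := by rw [← hu, inv_mul_cancel_right]
      have hc : Commute (u : K ⧸ stallings p K (m + (n + 1 + 1))) (x : K ⧸ _) := by
        refine commute_mk_iff.2 ?_
        exact hS.antitone (by lia) (hS.commutator_mem hum
          (show x ∈ stallings p K 1 from Subgroup.mem_top x))
      have hup : ((u ^ p : K) : K ⧸ stallings p K (m + (n + 1 + 1))) = 1 :=
        (QuotientGroup.eq_one_iff _).2 (pow_mem_stallings hum)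
      rw [mem_fixedMod, ← QuotientGroup.eq_one_iff, smul_pow', hgx, QuotientGroup.mk_mul,
        QuotientGroup.mk_inv, mul_inv_eq_one, QuotientGroup.mk_pow, QuotientGroup.mk_mul,
        hc.mul_pow, ← QuotientGroup.mk_pow, hup, one_mul, QuotientGroup.mk_pow]
    · intro a _ b hb
      rw [mem_fixedMod]
      exact hS.smul_commutator_mem rfl hb (hg a) (ih b hb)

end Stallings

/-! ### The Zassenhaus series -/

section Zassenhaus

/-- Take `p ^ e` to be the exact power of `p` in `r` and use `r * (p ^ j).choose r = p ^ j * (p ^ j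
- 1).choose (r - 1)`. -/
theorem exists_pow_dvd_choose_prime_pow {p : ℕ} (hp : p.Prime) {j r : ℕ} (hr : 1 ≤ r)
    (hrj : r ≤ p ^ j) : ∃ e ≤ j, p ^ e ≤ r ∧ p ^ (j - e) ∣ (p ^ j).choose r := by
  obtain ⟨e, r', hr', rfl⟩ := Nat.exists_eq_pow_mul_and_not_dvd (by lia : r ≠ 0) p hp.ne_one
  have hr0 : 0 < r' := Nat.pos_of_ne_zero (by rintro rfl; simp at hr')
  have he : p ^ e ≤ p ^ e * r' := Nat.le_mul_of_pos_right _ hr0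
  have hej : e ≤ j := (Nat.pow_le_pow_iff_right hp.one_lt).1 (he.trans hrj)
  refine ⟨e, hej, he, ?_⟩
  have hpe : 0 < p ^ e := pow_pos hp.pos _
  obtain ⟨P, hP⟩ : ∃ P, p ^ j = P + 1 := ⟨p ^ j - 1, (Nat.sub_add_cancel (pow_pos hp.pos _)).symm⟩
  obtain ⟨R, hR⟩ : ∃ R, p ^ e * r' = R + 1 := ⟨p ^ e * r' - 1, (Nat.sub_add_cancel hr).symm⟩
  have h := Nat.add_one_mul_choose_eq P R
  rw [← hP, ← hR] at h
  have hj : p ^ j = p ^ e * p ^ (j - e) := by rw [← pow_add, Nat.add_sub_cancel' hej]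
  have h' : p ^ (j - e) * P.choose R = (p ^ j).choose (p ^ e * r') * r' := by
    apply Nat.eq_of_mul_eq_mul_left hpe
    rw [← mul_assoc, ← hj, h]
    ring
  exact (Nat.Coprime.pow_left _ ((Nat.Prime.coprime_iff_not_dvd hp).2 hr')).dvd_of_dvd_mul_right
    ⟨_, h'.symm⟩

variable {K : Type*} [Group K] {p : ℕ}

theorem zassenhaus_le_iff {m : ℕ} {T : Subgroup K} : zassenhaus p K m ≤ T ↔
    ∀ i j, 1 ≤ i → m ≤ i * p ^ j → ∀ x ∈ lowerCentral K i, x ^ p ^ j ∈ T := by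
  simp only [zassenhaus, iSup_le_iff, powSubgroup_le_iff]

theorem pow_mem_zassenhaus {m i j : ℕ} (hi : 1 ≤ i) (h : m ≤ i * p ^ j) {x : K}
    (hx : x ∈ lowerCentral K i) : x ^ p ^ j ∈ zassenhaus p K m :=
  zassenhaus_le_iff.1 le_rfl i j hi h x hx

theorem zassenhaus_zero (p : ℕ) (K : Type*) [Group K] : zassenhaus p K 0 = ⊤ :=
  eq_top_iff.2 fun x _ => by
    simpa using pow_mem_zassenhaus (p := p) (m := 0) (i := 1) (j := 0) le_rfl (by simp)
      (Subgroup.mem_top x)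

theorem zassenhaus_one (p : ℕ) (K : Type*) [Group K] : zassenhaus p K 1 = ⊤ :=
  eq_top_iff.2 fun x _ => by
    simpa using pow_mem_zassenhaus (p := p) (m := 1) (i := 1) (j := 0) le_rfl (by simp)
      (Subgroup.mem_top x)

theorem isPoly₂_pow_fst {S : ℕ → Subgroup K} (hS : IsExtendedNSeries S) {i k : ℕ} {x : K}
    (hx : x ∈ S i) : IsPoly₂ S i k 0 (fun v => x ^ v.1) := by
  simpa using isPoly₂_pow_choose hS (s := 0) (r := 1) (t := 0) (i := i) (k := k) (by simpa using hx)

theorem isPoly₂_pow_snd {S : ℕ → Subgroup K} (hS : IsExtendedNSeries S) {i k : ℕ} {x : K}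
    (hx : x ∈ S k) : IsPoly₂ S i k 0 (fun v => x ^ v.2) := by
  simpa using isPoly₂_pow_choose hS (s := 0) (r := 0) (t := 1) (i := i) (k := k) (by simpa using hx)

/-- Expand `(a, b) ↦ ⁅x ^ a, y ^ b⁆` over the lower central series. Its coefficients lie in `Γ_{r i
+ t k}` with `r, t ≥ 1`, and the powers of `p` in the binomials make up for `r < p ^ j` and `t < p ^
l`. -/
theorem commutator_pow_pow_mem_zassenhaus (hp : p.Prime) {i j k l : ℕ} (hi : 1 ≤ i) {x y : K}
    (hx : x ∈ lowerCentral K i) (hy : y ∈ lowerCentral K k) :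
    ⁅x ^ p ^ j, y ^ p ^ l⁆ ∈ zassenhaus p K (i * p ^ j + k * p ^ l) := by
  have hS := lowerCentral_isExtendedNSeries K
  have hf := (isPoly₂_pow_fst hS (k := k) hx).commutator hS (isPoly₂_pow_snd hS (i := i) hy)
  refine hf.apply_mem_of_pow_choose_mem hS (r₀ := 1) (t₀ := 1) (A := p ^ j) (B := p ^ l) ?_ ?_
  · intro r t hr hrA ht htB c hc
    obtain ⟨e, hej, her, a, ha⟩ := exists_pow_dvd_choose_prime_pow hp hr hrA
    obtain ⟨e', hel, het, b, hb⟩ := exists_pow_dvd_choose_prime_pow hp ht htB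
    have h1 : p ^ j = p ^ e * p ^ (j - e) := by rw [← pow_add, Nat.add_sub_cancel' hej]
    have h2 : p ^ l = p ^ e' * p ^ (l - e') := by rw [← pow_add, Nat.add_sub_cancel' hel]
    have hle : i * p ^ j + k * p ^ l ≤ (0 + 0 + r * i + t * k) * p ^ (j - e + (l - e')) := by
      rw [h1, h2, pow_add]
      have hP : 1 ≤ p ^ (j - e) := Nat.one_le_pow _ _ hp.pos
      have hP' : 1 ≤ p ^ (l - e') := Nat.one_le_pow _ _ hp.pos
      calc i * (p ^ e * p ^ (j - e)) + k * (p ^ e' * p ^ (l - e'))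
          ≤ i * (r * p ^ (j - e)) * p ^ (l - e') + k * (t * p ^ (l - e')) * p ^ (j - e) :=
            add_le_add
              ((Nat.mul_le_mul le_rfl (Nat.mul_le_mul her le_rfl)).trans
                (Nat.le_mul_of_pos_right _ hP'))
              ((Nat.mul_le_mul le_rfl (Nat.mul_le_mul het le_rfl)).trans
                (Nat.le_mul_of_pos_right _ hP))
        _ = _ := by ring
    have hpos : 1 ≤ 0 + 0 + r * i + t * k := by
      have := Nat.mul_pos hr hi
      lia
    have := pow_mem (pow_mem_zassenhaus hpos hle hc) (a * b)
    convert this using 1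
    rw [ha, hb, ← pow_mul, pow_add]
    congr 1
    ring
  · rintro a b (h | h) <;>
      simp [Nat.lt_one_iff.1 h, commutatorElement_def]

theorem zassenhaus_isExtendedNSeries (hp : p.Prime) (K : Type*) [Group K] :
    IsExtendedNSeries (zassenhaus p K) := by
  have hN := (IsLowerCentralVariant.zassenhaus (K := K) p hp).normal
  have hanti : Antitone (zassenhaus p K) := fun a b hab =>
    zassenhaus_le_iff.2 fun i j hi h x hx => pow_mem_zassenhaus hi (hab.trans h) hx
  refine IsExtendedNSeries.of_pos (zassenhaus_zero p K) hanti hN fun m n => ?_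
  have hNN := hN (m + 1 + (n + 1))
  refine (Subgroup.commutator_le).2 fun x hx y hy => ?_
  rw [← mem_centralizerMod]
  revert x
  refine zassenhaus_le_iff.2 fun i j hi hm x hx => ?_
  rw [mem_centralizerMod_comm]
  revert y
  refine zassenhaus_le_iff.2 fun k l hk hn y hy => ?_
  rw [mem_centralizerMod_comm, mem_centralizerMod]
  exact hanti (by lia) (commutator_pow_pow_mem_zassenhaus hp hi hx hy)

/-- Clear on the generators; the point is that `p`-th powers of products behave, since `(x * y) ^ p`
differs from `x ^ p * y ^ p` by deep enough terms. -/
theorem pow_prime_mem_zassenhaus (hp : p.Prime) {b : ℕ} {z : K} (hz : z ∈ zassenhaus p K b) :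
    z ^ p ∈ zassenhaus p K (p * b) := by
  have hS := zassenhaus_isExtendedNSeries hp K
  -- Truncating at `N` allows downward induction on `b`: for `b ≥ N` nothing is left to prove.
  suffices key : ∀ N q b, N ≤ b + q →
      ∀ z ∈ zassenhaus p K b, z ^ p ∈ zassenhaus p K (min N (p * b)) by
    have := key (p * b) (p * b) b (by lia) z hz
    rwa [min_self] at this
  intro N q
  induction q with
  | zero =>
    intro b hb z hz
    exact hS.antitone (by lia) (pow_mem hz p)
  | succ q ih =>
    intro b hb
    rcases Nat.eq_zero_or_pos b with rfl | hb0
    · intro z _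
      simp [zassenhaus_zero]
    have hNT := hS.normal (min N (p * b))
    have hmul : ∀ x ∈ zassenhaus p K b, ∀ y ∈ zassenhaus p K b,
        (y ^ p)⁻¹ * (x ^ p)⁻¹ * (x * y) ^ p ∈ zassenhaus p K (min N (p * b)) := by
      intro x hx y hy
      -- The map `a ↦ y⁻ᵃ x⁻ᵃ (xy)ᵃ` is trivial at `0` and `1`, so only `r ≥ 2` occurs and
      -- coefficients lie strictly deeper than `b`. For `r < p` the binomial is divisible by `p` and
      -- induction applies; for `r = p` depth `p * b` is already reached.
      have hf := (((isPoly₂_pow_fst hS (k := 0) hy).inv hS).mul hS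
        ((isPoly₂_pow_fst hS (k := 0) hx).inv hS)).mul hS
        (isPoly₂_pow_fst hS (k := 0) (mul_mem hx hy))
      refine hf.apply_mem_of_pow_choose_mem hS (r₀ := 2) (t₀ := 0) (A := p) (B := 0) ?_ ?_
      · intro r t hr hrA _ ht c hc
        obtain rfl : t = 0 := by lia
        rw [Nat.choose_self, mul_one]
        have hrb : b + 1 ≤ r * b := by nlinarith
        rcases hrA.lt_or_eq with hrA | rfl
        · obtain ⟨a, ha⟩ := hp.dvd_choose_self (by lia) hrA
          rw [ha, pow_mul]
          have h := ih (r * b) (by lia) c (by simpa using hc)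
          refine pow_mem (hS.antitone ?_ h) a
          exact min_le_min le_rfl (Nat.mul_le_mul le_rfl (by lia))
        · rw [Nat.choose_self, pow_one]
          exact hS.antitone (by simp) hc
      · rintro a b (h | h)
        · interval_cases a <;> simp
        · lia
    let T : Subgroup K :=
      { carrier := {z | z ∈ zassenhaus p K b ∧ z ^ p ∈ zassenhaus p K (min N (p * b))}
        one_mem' := ⟨one_mem _, by simp⟩
        mul_mem' := by
          rintro x y ⟨hx, hxp⟩ ⟨hy, hyp⟩
          refine ⟨mul_mem hx hy, ?_⟩
          have := mul_mem (mul_mem hxp hyp) (hmul x hx y hy)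
          simpa [mul_assoc] using this
        inv_mem' := by
          rintro x ⟨hx, hxp⟩
          exact ⟨inv_mem hx, by simpa using hxp⟩ }
    have hT : zassenhaus p K b ≤ T := by
      refine zassenhaus_le_iff.2 fun i j hi h x hx => ⟨pow_mem_zassenhaus hi h hx, ?_⟩
      rw [← pow_mul, ← pow_succ]
      refine pow_mem_zassenhaus hi ((min_le_right _ _).trans ?_) hx
      calc p * b ≤ p * (i * p ^ j) := Nat.mul_le_mul le_rfl h
        _ = i * p ^ (j + 1) := by ring
    exact fun z hz => (hT hz).2

theorem mul_pow_mul_inv_mem_zassenhaus (hp : p.Prime) {m i : ℕ} {u x : K}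
    (hu : u ∈ zassenhaus p K (m + i)) (hx : x ∈ zassenhaus p K i) :
    (u * x) ^ p * (x ^ p)⁻¹ ∈ zassenhaus p K (m + p * i) := by
  have hS := zassenhaus_isExtendedNSeries hp K
  have hxp := isPoly₂_pow_fst hS (k := 0) hx
  have hNm := hS.normal m
  have hum : u ∈ zassenhaus p K m := hS.antitone (by lia) hu
  -- Closure under products would only give degree `0`. Degree `m` comes from the values being
  -- trivial modulo `S m` and the difference being `xᵃ u x⁻ᵃ = ⁅xᵃ, u⁆ * u`, of degree `m + i`.
  have hf : IsPoly₂ (zassenhaus p K) i 0 m (fun v => (u * x) ^ v.1 * (x ^ v.1)⁻¹) := by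
    have hfm : ∀ v : ℕ × ℕ, (u * x) ^ v.1 * (x ^ v.1)⁻¹ ∈ zassenhaus p K m := by
      intro v
      rw [← QuotientGroup.eq_one_iff, QuotientGroup.mk_mul, QuotientGroup.mk_inv,
        mul_inv_eq_one, QuotientGroup.mk_pow, QuotientGroup.mk_mul,
        (QuotientGroup.eq_one_iff u).2 hum, one_mul, QuotientGroup.mk_pow]
    have hconst : IsPoly₂ (zassenhaus p K) i 0 (m + i) (fun _ => u) := by
      simpa using isPoly₂_pow_choose hS (s := m + i) (r := 0) (t := 0) (i := i) (k := 0)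
        (by simpa using hu)
    have hd := (hxp.commutator hS hconst).mul hS (f := _) (g := fun _ => u) (by simpa using hconst)
    rw [zero_add] at hd
    intro d
    cases d with
    | zero => exact hfm
    | succ d =>
      refine ⟨hfm, Bool.forall_bool.2 ⟨?_, ?_⟩⟩
      · change IsPoly _ _ _ d (m + 0) (diff (fun v => (v.1, v.2 + 1)) _)
        convert isPoly_one d (m + 0) using 1
        ext v
        simp [diff]
      · change IsPoly _ _ _ d (m + i) (diff (fun v => (v.1 + 1, v.2)) _)
        convert hd d using 1
        ext v
        simp only [diff, pow_succ, Pi.mul_apply, commutatorElement_def, Pi.inv_apply]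
        group
  refine hf.apply_mem_of_pow_choose_mem hS (r₀ := 1) (t₀ := 0) (A := p) (B := 0) ?_ ?_
  · intro r t hr hrA _ ht c hc
    obtain rfl : t = 0 := by lia
    rw [Nat.choose_self, mul_one]
    rcases hrA.lt_or_eq with hrA | rfl
    · obtain ⟨a, ha⟩ := hp.dvd_choose_self (by lia) hrA
      rw [ha, pow_mul]
      refine pow_mem (hS.antitone ?_ (pow_prime_mem_zassenhaus hp hc)) a
      have h1 : m ≤ p * m := Nat.le_mul_of_pos_left _ hp.pos
      have h2 : p * i ≤ p * (r * i) := Nat.mul_le_mul le_rfl (Nat.le_mul_of_pos_left _ hr)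
      rw [mul_add, mul_add]
      lia
    · rw [Nat.choose_self, pow_one]
      simpa using hc
  · rintro a b (h | h)
    · simp [Nat.lt_one_iff.1 h]
    · lia

theorem smul_mul_inv_mem_zassenhaus (hp : p.Prime) {G : Type*} [Group G] [MulDistribMulAction G K]
    {g : G} {m : ℕ} (hg : ∀ k : K, (g • k) * k⁻¹ ∈ zassenhaus p K (m + 1)) {n : ℕ} {x : K}
    (hx : x ∈ zassenhaus p K n) :
    (g • x) * x⁻¹ ∈ zassenhaus p K (m + n) := by
  have hS := zassenhaus_isExtendedNSeries hp K
  have hN := hS.normal (m + n)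
  suffices h : zassenhaus p K n ≤ fixedMod (zassenhaus p K (m + n)) g from mem_fixedMod.1 (h hx)
  clear x hx
  refine zassenhaus_le_iff.2 fun i j hi hn x hx => ?_
  rw [mem_fixedMod]
  suffices h : (g • x ^ p ^ j) * (x ^ p ^ j)⁻¹ ∈ zassenhaus p K (m + i * p ^ j) from
    hS.antitone (by lia) h
  clear hn
  -- Each further `p`-th power multiplies the depth of `x ^ p ^ j` by `p` while the gain `m`
  -- persists.
  induction j with
  | zero =>
    simpa using smul_mul_inv_mem_of_mem_lowerCentral hS (zassenhaus_one p K) hg hx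
  | succ j ih =>
    have h := mul_pow_mul_inv_mem_zassenhaus hp ih (pow_mem_zassenhaus hi le_rfl hx)
    rw [inv_mul_cancel_right, ← smul_pow', ← pow_mul, ← pow_succ] at h
    convert h using 2
    ring

end Zassenhaus

end NSeries

theorem proposition8p3 {K G : Type*} [Group K] [Group G] [MulDistribMulAction G K]
    (S : ℕ → Subgroup K) (hS : NSeries.IsLowerCentralVariant S) :
    NSeries.IsExtendedNSeries S ∧
    (∀ m : ℕ, NSeries.johnsonFiltration S (hS.actsOn G) m =
      NSeries.kernelFiltration S hS.normal (hS.actsOn G) m) ∧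
    NSeries.IsExtendedNSeries (NSeries.kernelFiltration S hS.normal (hS.actsOn G)) := by
  have h : NSeries.IsExtendedNSeries S ∧ S 1 = ⊤ ∧ ∀ (m : ℕ) (g : G),
      (∀ k : K, (g • k) * k⁻¹ ∈ S (m + 1)) →
      ∀ n, ∀ x ∈ S (n + 1), (g • x) * x⁻¹ ∈ S (m + (n + 1)) := by
    cases hS with
    | lowerCentral =>
      exact ⟨NSeries.lowerCentral_isExtendedNSeries K, rfl, fun m g hg n x hx =>
        NSeries.smul_mul_inv_mem_of_mem_lowerCentral
          (NSeries.lowerCentral_isExtendedNSeries K) rfl hg hx⟩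
    | rational =>
      exact ⟨NSeries.rationalLowerCentral_isExtendedNSeries K, NSeries.rationalLowerCentral_one K,
        fun m g hg n x hx => NSeries.smul_mul_inv_mem_rationalLowerCentral hg hx⟩
    | zassenhaus p hp =>
      exact ⟨NSeries.zassenhaus_isExtendedNSeries hp K, NSeries.zassenhaus_one p K,
        fun m g hg n x hx => NSeries.smul_mul_inv_mem_zassenhaus hp hg hx⟩
    | stallings p hp =>
      exact ⟨NSeries.stallings_isExtendedNSeries hp K, rfl,
        fun m g hg => NSeries.smul_mul_inv_mem_stallings hp hg⟩
  obtain ⟨hext, h1, hpos⟩ := h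
  have heq : NSeries.johnsonFiltration S (hS.actsOn G) =
      NSeries.kernelFiltration S hS.normal (hS.actsOn G) :=
    funext fun m => NSeries.johnsonFiltration_eq_kernelFiltration hext hS.normal (hS.actsOn G) m h1
      (hpos m)
  exact ⟨hext, congrFun heq, heq ▸ NSeries.johnsonFiltration_isExtendedNSeries hext (hS.actsOn G)⟩
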